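/- For $n\in\mathbb N$ let $\mu$ be the uniform probability measure on $\{0,1\}^n$. For $f\in\mathbb R[x_1,\dots,x_n]$ put $f_{\min}=\min_{x\in\{0,1\}^n}f(x)$ and $\|f\|_\infty=\max_{x\in\{0,1\}^n}|f(x)|$. Let $\Sigma_r$ be the set of finite sums $\sum_i p_i^2$ with $p_i\in\mathbb R[x]$, $\deg p_i\le r$. The outer and inner bounds of order $r\in\mathbb N$ are $$f_{(r)}=\sup\{\lambda\in\mathbb R:\ \exists s\in\Sigma_r,\ f(x)-\lambda=s(x)\ \ \forall x\in\{0,1\}^n\},$$ $$f^{(r)}=\inf\Big\{\int fs\,d\mu:\ s\in\Sigma_r,\ \int s\,d\mu=1\Big\},$$ with values in $[-\infty,\infty]$ (so $f_{(r)}=-\infty$ if no $\lambda$ is feasible). For $d\in\mathbb N$ define the worst-case errors $$E_{(r)}(n)=\sup\{f_{\min}-f_{(r)}:\ \deg f\le d,\ \|f\|_\infty=1\},\qquad E^{(r)}(n)=\sup\{f^{(r)}-f_{\min}:\ \deg f\le d,\ \|f\|_\infty=1\},$$ the suprema being over $f\in\mathbb R[x_1,\dots,x_n]$. For $S\subseteq[n]$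 let $\chi_S(x)=\prod_{i\in S}(1-2x_i)$, and for a polynomial $p$ let $p_k=\sum_{|S|=k}\big(\int p\,\chi_S\,d\mu\big)\chi_S$ be its harmonic component of degree $k$ on $\{0,1\}^n$. Let $\gamma_d$ be the infimum of all real $\gamma$ such that $\|p_k\|_\infty\le\gamma\|p\|_\infty$ for all $n\in\mathbb N$, all $p\in\mathbb R[x_1,\dots,x_n]$ with $\deg p\le d$ and all $0\le k\le d$. Put $C_d=d(d+1)\gamma_d$, a constant depending only on $d$, and $\varphi(t)=\tfrac12-\sqrt{t(1-t)}$. Then $\gamma_d$ is finite and is itself such a $\gamma$, $C_d>0$ if $d\ge1$, and for every $t\in[0,\tfrac12]$ and all sequences $(n_j)_j$, $(r_j)_j$ of natural numbers with $n_j\to\infty$ and $r_j/n_j\to t$ we have $$\limsup_{j\to\infty}E^{(r_j)}(n_j)\le C_d\,\varphi(t),$$ and, if $d(d+1)\varphi(t)\le\tfrac12$, also $$\limsup_{j\to\infty}E_{(r_j)}(n_j)\le 2\,C_d\,\varphi(t).$$ -/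

import Mathlib

open Filter Topology

noncomputable section

namespace BoolCube

/-- The points of the boolean cube `{0,1}^n`. -/
abbrev Cube (n : ℕ) := Fin n → Bool

/-- A point of the cube as a `0/1` vector of `ℝⁿ`. -/
def toReal {n : ℕ} (x : Cube n) : Fin n → ℝ := fun i => if x i then 1 else 0

/-- The function on the cube defined by a polynomial. -/
def onCube {n : ℕ} (p : MvPolynomial (Fin n) ℝ) (x : Cube n) : ℝ :=
  MvPolynomial.eval (toReal x) p

/-- The integral with respect to the uniform probability measure on the cube. -/
def integral {n : ℕ} (g : Cube n → ℝ) : ℝ := (∑ x, g x) / 2 ^ n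

/-- The minimum `f_min` of a polynomial over the cube. -/
def fMin {n : ℕ} (p : MvPolynomial (Fin n) ℝ) : ℝ := ⨅ x : Cube n, onCube p x

/-- The norm `‖f‖_∞ = max_{x ∈ {0,1}^n} |f x|`. -/
def supNorm {n : ℕ} (p : MvPolynomial (Fin n) ℝ) : ℝ := ⨆ x : Cube n, |onCube p x|

/-- `s ∈ Σ_r`: the polynomial `s` is a finite sum of squares of polynomials of degree `≤ r`. -/
def IsSOS {n : ℕ} (r : ℕ) (s : MvPolynomial (Fin n) ℝ) : Prop :=
  ∃ (m : ℕ) (q : Fin m → MvPolynomial (Fin n) ℝ),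
    (∀ i, (q i).totalDegree ≤ r) ∧ s = ∑ i, q i ^ 2

/-- The outer bound `f_(r)`: the supremum of the reals `c` such that `f - c` agrees on the cube
with an element of `Σ_r`. It is `-∞` if there is no such `c`. -/
def outerBound {n : ℕ} (r : ℕ) (p : MvPolynomial (Fin n) ℝ) : EReal :=
  sSup {e : EReal | ∃ c : ℝ, e = (c : EReal) ∧
    ∃ s : MvPolynomial (Fin n) ℝ, IsSOS r s ∧ ∀ x : Cube n, onCube p x - c = onCube s x}

/-- The inner bound `f^(r)`: the infimum of `∫ f s dμ` over `s ∈ Σ_r` with `∫ s dμ = 1`. -/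
def innerBound {n : ℕ} (r : ℕ) (p : MvPolynomial (Fin n) ℝ) : EReal :=
  sInf {e : EReal | ∃ s : MvPolynomial (Fin n) ℝ, IsSOS r s ∧ integral (onCube s) = 1 ∧
    e = ((integral fun x => onCube p x * onCube s x : ℝ) : EReal)}

/-- The worst-case error `E_(r)(n)` of the outer bound over polynomials of degree `≤ d` in `n`
variables with `‖f‖_∞ = 1`. -/
def outerError (d r n : ℕ) : EReal :=
  sSup {e : EReal | ∃ p : MvPolynomial (Fin n) ℝ, p.totalDegree ≤ d ∧ supNorm p = 1 ∧
    e = (fMin p : EReal) - outerBound r p}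

/-- The worst-case error `E^(r)(n)` of the inner bound over polynomials of degree `≤ d` in `n`
variables with `‖f‖_∞ = 1`. -/
def innerError (d r n : ℕ) : EReal :=
  sSup {e : EReal | ∃ p : MvPolynomial (Fin n) ℝ, p.totalDegree ≤ d ∧ supNorm p = 1 ∧
    e = innerBound r p - (fMin p : EReal)}

/-- The character `χ_S(x) = ∏_{i ∈ S} (1 - 2 x_i) = (-1)^{∑_{i ∈ S} x_i}`. -/
def character {n : ℕ} (S : Finset (Fin n)) (x : Cube n) : ℝ := ∏ i ∈ S, (1 - 2 * toReal x i)

/-- The harmonic component of degree `k` of `g`: the part of its Fourier expansion on the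
characters `χ_S` with `|S| = k`. -/
def harmonicComponent {n : ℕ} (k : ℕ) (g : Cube n → ℝ) (x : Cube n) : ℝ :=
  ∑ S ∈ Finset.powersetCard k (Finset.univ : Finset (Fin n)),
    integral (fun y => g y * character S y) * character S x

/-- `γ` bounds the harmonic components of all polynomials of degree `≤ d` on all cubes:
`‖p_k‖_∞ ≤ γ ‖p‖_∞` for `k ≤ d`, uniformly in the dimension. -/
def IsHarmonicBound (d : ℕ) (γ : ℝ) : Prop :=
  ∀ (n : ℕ) (p : MvPolynomial (Fin n) ℝ), p.totalDegree ≤ d → ∀ k ≤ d, ∀ x : Cube n,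
    |harmonicComponent k (onCube p) x| ≤ γ * supNorm p

/-- The least dimension-free bound `γ_d` on harmonic components. -/
def gammaConst (d : ℕ) : ℝ := sInf {γ : ℝ | IsHarmonicBound d γ}

/-- The constant `C_d = d (d + 1) γ_d`. -/
def errorConst (d : ℕ) : ℝ := d * (d + 1) * gammaConst d

/-- `φ(t) = 1/2 - √(t (1 - t))`. -/
def phi (t : ℝ) : ℝ := 1 / 2 - Real.sqrt (t * (1 - t))

end BoolCube

end

/-! Both bounds come from one kernel `zonal c (shift x y) ^ 2`, where `zonal c` has degree at most
`r` and `L²` norm one. Permutation invariance makes convolution with it act on the harmonic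
component of degree `k` as a scalar `l k`, with `l 0 = 1`. If `l 1 ≥ 1 - 2 a`, then `1 - l k ≤ 2 k
a`, since `1 - χ_S` is at most the sum of `1 - χ_i` over `i ∈ S` (`one_sub_eigenvalue_le`).

For the inner bound, the kernel centred at a minimiser is a density, and the error is a sum of terms
`(1 - l k) γ_d`; summing `2 k a γ_d` over `1 ≤ k ≤ d` gives `C_d a`. For the outer bound, the kernel
operator is inverted: the preimage of `f - f_min + ε` is nonnegative once `ε` absorbs the terms `((l
k)⁻¹ - 1) γ_d`, and its image is then a sum of squares.

It remains to reach any `a > φ(t)`. Equal mass on the `m + 1` top degrees up to `r` yields `l 1`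
asymptotically at least `2 (m / (m + 1)) √(t (1 - t))` (`exists_zonal_of_window`), and `1 - 2 φ(t) =
2 √(t (1 - t))`.

Finiteness of `γ_d`: the noise operator turns `p` into `∑ ρ ^ k p_k` without increasing the sup
norm, and coefficients of a polynomial in `ρ` are bounded by its values on `[0, 1]`. -/

noncomputable section

namespace BoolCube

variable {n : ℕ}

/-! ### Characters and Fourier expansion -/

/-- Coordinatewise addition modulo two. -/
def shift (x y : Cube n) : Cube n := fun i => xor (x i) (y i)

lemma shift_comm (x y : Cube n) : shift x y = shift y x := by
  funext i; simp [shift, Bool.xor_comm]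

lemma shift_shift (x y : Cube n) : shift x (shift x y) = y := by
  funext i; simp [shift]

lemma shift_eq_zero_iff (x y : Cube n) : shift x y = (fun _ => false) ↔ x = y := by
  simp [shift, funext_iff]

lemma sum_shift (x : Cube n) (g : Cube n → ℝ) : ∑ y, g (shift x y) = ∑ y, g y :=
  Equiv.sum_comp (Function.Involutive.toPerm (shift x) (shift_shift x)) g

lemma integral_shift (x : Cube n) (g : Cube n → ℝ) :
    integral (fun y => g (shift x y)) = integral g := by
  simp only [integral, sum_shift]

lemma integral_const (a : ℝ) : integral (fun _ : Cube n => a) = a := by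
  simp [integral]

lemma integral_add (g h : Cube n → ℝ) :
    integral (fun x => g x + h x) = integral g + integral h := by
  simp only [integral, Finset.sum_add_distrib, add_div]

lemma integral_sub (g h : Cube n → ℝ) :
    integral (fun x => g x - h x) = integral g - integral h := by
  simp only [integral, Finset.sum_sub_distrib, sub_div]

lemma integral_const_mul (a : ℝ) (g : Cube n → ℝ) :
    integral (fun x => a * g x) = a * integral g := by
  simp only [integral, ← Finset.mul_sum, mul_div_assoc]

lemma integral_sum {ι : Type*} (s : Finset ι) (g : ι → Cube n → ℝ) :
    integral (fun x => ∑ i ∈ s, g i x) = ∑ i ∈ s, integral (g i) := by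
  simp only [integral, Finset.sum_div]
  exact Finset.sum_comm

lemma integral_mono {g h : Cube n → ℝ} (hgh : ∀ x, g x ≤ h x) : integral g ≤ integral h := by
  unfold integral
  gcongr
  exact hgh _

lemma one_sub_two_mul_toReal (x : Cube n) (i : Fin n) :
    1 - 2 * toReal x i = if x i then -1 else 1 := by
  unfold toReal; split_ifs <;> norm_num

lemma character_empty (x : Cube n) : character ∅ x = 1 := by simp [character]

lemma character_shift (S : Finset (Fin n)) (x y : Cube n) :
    character S (shift x y) = character S x * character S y := by
  simp only [character, one_sub_two_mul_toReal, shift, ← Finset.prod_mul_distrib]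
  refine Finset.prod_congr rfl fun i _ => ?_
  by_cases hx : x i = true <;> by_cases hy : y i = true <;> simp [hx, hy]

lemma character_eq_one_or (S : Finset (Fin n)) (x : Cube n) :
    character S x = 1 ∨ character S x = -1 := by
  classical
  induction S using Finset.induction_on with
  | empty => simp [character]
  | insert i S hi ih =>
    have : character (insert i S) x = (1 - 2 * toReal x i) * character S x := by
      simp [character, hi]
    rw [this, one_sub_two_mul_toReal]
    rcases ih with h | h <;> rw [h] <;> split_ifs <;> norm_num

lemma character_mul (S T : Finset (Fin n)) (x : Cube n) :
    character S x * character T x = character (symmDiff S T) x := by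
  classical
  have h (S : Finset (Fin n)) :
      character S x = ∏ i, if i ∈ S then (if x i then (-1 : ℝ) else 1) else 1 := by
    simp only [character, one_sub_two_mul_toReal]
    rw [Finset.prod_ite_mem, Finset.univ_inter]
  rw [h, h, h, ← Finset.prod_mul_distrib]
  refine Finset.prod_congr rfl fun i _ => ?_
  by_cases hS : i ∈ S <;> by_cases hT : i ∈ T <;> simp [Finset.mem_symmDiff, hS, hT]
  split_ifs <;> norm_num

/-- Integrating a function that changes sign under a coordinate flip gives zero. -/
lemma integral_eq_zero_of_flip (i : Fin n) {g : Cube n → ℝ}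
    (hg : ∀ x, g (shift (fun j => decide (j = i)) x) = -g x) : integral g = 0 := by
  have h := integral_shift (fun j => decide (j = i)) g
  simp only [hg] at h
  have h2 := integral_const_mul (-1) g
  simp only [neg_one_mul] at h2
  linarith

lemma character_flip {i : Fin n} {S : Finset (Fin n)} (hi : i ∈ S) (x : Cube n) :
    character S (shift (fun j => decide (j = i)) x) = -character S x := by
  have : character S (fun j => decide (j = i)) = -1 := by
    simp only [character, one_sub_two_mul_toReal, decide_eq_true_eq]
    rw [Finset.prod_ite_eq' S i (fun _ => (-1 : ℝ)), if_pos hi]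
  rw [character_shift, this, neg_one_mul]

lemma integral_character (S : Finset (Fin n)) :
    integral (character S) = if S = ∅ then 1 else 0 := by
  split_ifs with h
  · subst h
    simp only [funext character_empty, integral_const]
  · obtain ⟨i, hi⟩ := Finset.nonempty_iff_ne_empty.2 h
    exact integral_eq_zero_of_flip i (character_flip hi)

lemma integral_character_mul (S T : Finset (Fin n)) :
    integral (fun x => character S x * character T x) = if S = T then 1 else 0 := by
  simp only [character_mul]
  rw [integral_character]
  simp [← Finset.bot_eq_empty, symmDiff_eq_bot]

/-- The product form of the noise kernel. -/
lemma prod_one_add_eq_sum_character (ρ : ℝ) (x : Cube n) :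
    ∏ i, (1 + ρ * (1 - 2 * toReal x i)) = ∑ S : Finset (Fin n), ρ ^ S.card * character S x := by
  classical
  rw [Finset.prod_one_add, Finset.powerset_univ]
  refine Finset.sum_congr rfl fun S _ => ?_
  rw [Finset.prod_mul_distrib, Finset.prod_const, character]

lemma sum_character (x : Cube n) :
    ∑ S : Finset (Fin n), character S x = if x = (fun _ => false) then 2 ^ n else 0 := by
  have h := prod_one_add_eq_sum_character 1 x
  simp only [one_pow, one_mul] at h
  rw [← h]
  split_ifs with hx
  · subst hx
    simp [toReal]; norm_num
  · obtain ⟨i, hi⟩ := Function.ne_iff.1 hx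
    refine Finset.prod_eq_zero (Finset.mem_univ i) ?_
    rw [one_sub_two_mul_toReal, if_pos (by simpa using hi)]; norm_num

/-- Fourier inversion on the cube. -/
lemma fourier_inversion (g : Cube n → ℝ) (x : Cube n) :
    g x = ∑ S : Finset (Fin n), integral (fun y => g y * character S y) * character S x := by
  have h : ∀ S : Finset (Fin n), integral (fun y => g y * character S y) * character S x =
      integral (fun y => g y * character S (shift x y)) := fun S => by
    rw [mul_comm, ← integral_const_mul]
    simp only [character_shift]
    congr 1; funext y; ring
  simp only [h]
  rw [← integral_sum]
  simp only [← Finset.mul_sum, sum_character, shift_eq_zero_iff]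
  simp [integral]

/-- Grouping the characters by degree. -/
lemma sum_eq_sum_powersetCard (F : Finset (Fin n) → ℝ) :
    ∑ S : Finset (Fin n), F S =
      ∑ k ∈ Finset.range (n + 1), ∑ S ∈ Finset.powersetCard k Finset.univ, F S := by
  rw [← Finset.powerset_univ, Finset.sum_powerset]
  simp

/-! ### Polynomials of bounded degree -/

/-- A monomial of degree at most `d` involves at most `d` variables, so it misses some `i ∈ S`;
flipping that coordinate changes only the sign of the character. -/
lemma integral_onCube_mul_character_eq_zero {d : ℕ} {p : MvPolynomial (Fin n) ℝ}
    (hp : p.totalDegree ≤ d) {S : Finset (Fin n)} (hS : d < S.card) :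
    integral (fun y => onCube p y * character S y) = 0 := by
  simp only [onCube, MvPolynomial.eval_eq, Finset.sum_mul]
  rw [integral_sum]
  refine Finset.sum_eq_zero fun m hm => ?_
  have hcard : m.support.card < S.card := by
    refine lt_of_le_of_lt ?_ hS
    refine le_trans ?_ ((MvPolynomial.le_totalDegree hm).trans hp)
    rw [Finset.card_eq_sum_ones]
    exact Finset.sum_le_sum fun i hi => Nat.one_le_iff_ne_zero.2 (Finsupp.mem_support_iff.1 hi)
  obtain ⟨i, hiS, him⟩ := Finset.exists_mem_notMem_of_card_lt_card hcard
  refine integral_eq_zero_of_flip i fun x => ?_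
  rw [character_flip hiS]
  have : ∏ j ∈ m.support, toReal (shift (fun j => decide (j = i)) x) j ^ m j =
      ∏ j ∈ m.support, toReal x j ^ m j := by
    refine Finset.prod_congr rfl fun j hj => ?_
    have hji : j ≠ i := fun h => him (h ▸ hj)
    simp [toReal, shift, hji]
  rw [this]; ring

lemma harmonicComponent_eq_zero_of_degree_lt {d k : ℕ} {p : MvPolynomial (Fin n) ℝ}
    (hp : p.totalDegree ≤ d) (hk : d < k) (x : Cube n) :
    harmonicComponent k (onCube p) x = 0 := by
  refine Finset.sum_eq_zero fun S hS => ?_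
  rw [integral_onCube_mul_character_eq_zero hp (by rw [(Finset.mem_powersetCard.1 hS).2]; exact hk),
    zero_mul]

lemma harmonicComponent_eq_zero_of_dim_lt {k : ℕ} (g : Cube n → ℝ) (hk : n < k) (x : Cube n) :
    harmonicComponent k g x = 0 := by
  rw [harmonicComponent, Finset.powersetCard_eq_empty.2 (by simpa using hk), Finset.sum_empty]

/-- A Fourier multiplier depending only on the degree acts on the harmonic components. -/
lemma sum_multiplier_eq_sum_harmonicComponent {d : ℕ} {p : MvPolynomial (Fin n) ℝ}
    (hp : p.totalDegree ≤ d) (a : ℕ → ℝ) (x : Cube n) :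
    ∑ S : Finset (Fin n), a S.card * (integral (fun y => onCube p y * character S y) *
        character S x) =
      ∑ k ∈ Finset.range (d + 1), a k * harmonicComponent k (onCube p) x := by
  have h1 : ∑ S : Finset (Fin n), a S.card * (integral (fun y => onCube p y * character S y) *
        character S x) =
      ∑ k ∈ Finset.range (n + 1), a k * harmonicComponent k (onCube p) x := by
    rw [sum_eq_sum_powersetCard]
    refine Finset.sum_congr rfl fun k _ => ?_
    rw [harmonicComponent, Finset.mul_sum]
    refine Finset.sum_congr rfl fun S hS => ?_
    rw [(Finset.mem_powersetCard.1 hS).2]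
  rw [h1]
  -- Components vanish above `n` and above `d`, so the two ranges of summation are interchangeable.
  rcases le_total n d with h | h
  · refine Finset.sum_subset (Finset.range_mono (by omega)) fun k _ hk => ?_
    rw [harmonicComponent_eq_zero_of_dim_lt _ (by simpa using hk), mul_zero]
  · refine (Finset.sum_subset (Finset.range_mono (by omega)) fun k _ hk => ?_).symm
    rw [harmonicComponent_eq_zero_of_degree_lt hp (by simpa using hk), mul_zero]

lemma onCube_eq_sum_harmonicComponent {d : ℕ} {p : MvPolynomial (Fin n) ℝ}
    (hp : p.totalDegree ≤ d) (x : Cube n) :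
    onCube p x = ∑ k ∈ Finset.range (d + 1), harmonicComponent k (onCube p) x := by
  have h := sum_multiplier_eq_sum_harmonicComponent hp (fun _ => 1) x
  simp only [one_mul] at h
  rw [← h, ← fourier_inversion]

lemma abs_onCube_le_supNorm (p : MvPolynomial (Fin n) ℝ) (x : Cube n) :
    |onCube p x| ≤ supNorm p :=
  le_ciSup (f := fun x => |onCube p x|) (Set.finite_range _).bddAbove x

lemma fMin_le (p : MvPolynomial (Fin n) ℝ) (x : Cube n) : fMin p ≤ onCube p x :=
  ciInf_le (f := fun x => onCube p x) (Set.finite_range _).bddBelow x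

lemma exists_onCube_eq_fMin (p : MvPolynomial (Fin n) ℝ) : ∃ x : Cube n, onCube p x = fMin p :=
  exists_eq_ciInf_of_finite

/-! ### The dimension-free bound on harmonic components -/

/-- The noise operator is a contraction for the sup norm. -/
lemma abs_sum_pow_mul_harmonicComponent_le {d : ℕ} {p : MvPolynomial (Fin n) ℝ}
    (hp : p.totalDegree ≤ d) {ρ : ℝ} (h0 : 0 ≤ ρ) (h1 : ρ ≤ 1) (x : Cube n) :
    |∑ k ∈ Finset.range (d + 1), ρ ^ k * harmonicComponent k (onCube p) x| ≤ supNorm p := by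
  -- A Riesz product: nonnegative factor by factor, of integral one, with coefficient `ρ ^ |S|` on
  -- the character of `S`.
  set K : Cube n → ℝ := fun y => ∏ i, (1 + ρ * (1 - 2 * toReal (shift x y) i)) with hK
  have hK0 : ∀ y, 0 ≤ K y := fun y => Finset.prod_nonneg fun i _ => by
    rw [one_sub_two_mul_toReal]; split_ifs <;> linarith
  have hKsum : ∀ y, K y = ∑ S : Finset (Fin n), ρ ^ S.card * (character S x * character S y) :=
    fun y => by simp only [hK, prod_one_add_eq_sum_character, character_shift]
  have hKint : integral K = 1 := by
    have : K = fun y => ∑ S : Finset (Fin n), (ρ ^ S.card * character S x) * character S y := by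
      funext y; rw [hKsum]; exact Finset.sum_congr rfl fun S _ => by ring
    rw [this, integral_sum]
    simp only [integral_const_mul]
    simp [integral_character, character_empty]
  have hrep : ∑ k ∈ Finset.range (d + 1), ρ ^ k * harmonicComponent k (onCube p) x =
      integral (fun y => onCube p y * K y) := by
    rw [← sum_multiplier_eq_sum_harmonicComponent hp]
    simp only [hKsum, Finset.mul_sum]
    rw [integral_sum]
    refine Finset.sum_congr rfl fun S _ => ?_
    rw [mul_comm (integral _), ← integral_const_mul, ← integral_const_mul]
    congr 1; funext y; ring
  rw [hrep, abs_le]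
  have hub : integral (fun y => supNorm p * K y) = supNorm p := by
    rw [integral_const_mul, hKint, mul_one]
  have hlb : integral (fun y => -supNorm p * K y) = -supNorm p := by
    rw [integral_const_mul, hKint, mul_one]
  constructor
  · rw [← hlb]
    exact integral_mono fun y => mul_le_mul_of_nonneg_right
      (abs_le.1 (abs_onCube_le_supNorm p y)).1 (hK0 y)
  · rw [← hub]
    exact integral_mono fun y => mul_le_mul_of_nonneg_right
      (abs_le.1 (abs_onCube_le_supNorm p y)).2 (hK0 y)

/-- Coefficients of a real polynomial are controlled by its values on `[0, 1]`. -/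
lemma exists_coeff_bound (d : ℕ) : ∃ γ : ℝ, ∀ (a : ℕ → ℝ) (B : ℝ),
    (∀ ρ : ℝ, 0 ≤ ρ → ρ ≤ 1 → |∑ k ∈ Finset.range (d + 1), ρ ^ k * a k| ≤ B) →
    ∀ k ≤ d, |a k| ≤ γ * B := by
  -- Interpolation at `d + 1` distinct nodes in `[0, 1]`: the inverse Vandermonde matrix recovers
  -- the coefficients, and its entries depend only on `d`.
  let v : Fin (d + 1) → ℝ := fun j => (j : ℝ) / (d + 1)
  have hv : Function.Injective v := fun i j hij => by
    have hd : (d : ℝ) + 1 ≠ 0 := by positivity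
    have : (i : ℝ) = (j : ℝ) := by
      simpa [v, div_left_inj' hd] using hij
    exact Fin.ext (by exact_mod_cast this)
  let V := Matrix.vandermonde v
  have hV : IsUnit V.det := (Matrix.det_vandermonde_ne_zero_iff.2 hv).isUnit
  refine ⟨∑ i, ∑ j, |V⁻¹ i j|, fun a B hB k hk => ?_⟩
  have hB0 : 0 ≤ B := (abs_nonneg _).trans (hB 0 le_rfl zero_le_one)
  let b : Fin (d + 1) → ℝ := fun i => a i
  have hVb : ∀ j, |(V.mulVec b) j| ≤ B := fun j => by
    have h := hB (v j) (by positivity)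
      ((div_le_one (by positivity)).2 (by exact_mod_cast j.2.le))
    rw [Finset.sum_range] at h
    simpa [Matrix.mulVec, dotProduct, V, Matrix.vandermonde_apply, b] using h
  let k' : Fin (d + 1) := ⟨k, by omega⟩
  have hk' : a k = ∑ j, V⁻¹ k' j * (V.mulVec b) j := by
    have : V⁻¹.mulVec (V.mulVec b) = b := by
      rw [Matrix.mulVec_mulVec, Matrix.nonsing_inv_mul _ hV, Matrix.one_mulVec]
    exact (congrFun this k').symm
  rw [hk']
  calc |∑ j, V⁻¹ k' j * (V.mulVec b) j| ≤ ∑ j, |V⁻¹ k' j| * B :=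
        (Finset.abs_sum_le_sum_abs _ _).trans (Finset.sum_le_sum fun j _ => by
          rw [abs_mul]; exact mul_le_mul_of_nonneg_left (hVb j) (abs_nonneg _))
    _ = (∑ j, |V⁻¹ k' j|) * B := by rw [Finset.sum_mul]
    _ ≤ _ := by
        refine mul_le_mul_of_nonneg_right ?_ hB0
        exact Finset.single_le_sum (f := fun i => ∑ j, |V⁻¹ i j|)
          (fun i _ => Finset.sum_nonneg fun j _ => abs_nonneg _) (Finset.mem_univ k')

lemma exists_isHarmonicBound (d : ℕ) : ∃ γ, IsHarmonicBound d γ := by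
  obtain ⟨γ, hγ⟩ := exists_coeff_bound d
  exact ⟨γ, fun n p hp k hk x => hγ (fun k => harmonicComponent k (onCube p) x) _
    (fun ρ h0 h1 => abs_sum_pow_mul_harmonicComponent_le hp h0 h1 x) k hk⟩

lemma one_le_of_isHarmonicBound {d : ℕ} {γ : ℝ} (h : IsHarmonicBound d γ) : 1 ≤ γ := by
  have h1 := h 0 1 (by simp) 0 (Nat.zero_le _) (fun _ => false)
  simpa [harmonicComponent, onCube, supNorm, integral, character] using h1

/-- The infimum is attained: the conditions on `γ` are closed, and the set is nonempty and bounded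
below by one. -/
lemma isHarmonicBound_gammaConst (d : ℕ) : IsHarmonicBound d (gammaConst d) := by
  have hclosed : IsClosed {γ : ℝ | IsHarmonicBound d γ} := by
    simp only [IsHarmonicBound, Set.ofPred_forall]
    refine isClosed_iInter fun n => isClosed_iInter fun p => isClosed_iInter fun _ =>
      isClosed_iInter fun k => isClosed_iInter fun _ => isClosed_iInter fun x => ?_
    exact isClosed_le continuous_const (by fun_prop)
  exact hclosed.csInf_mem (exists_isHarmonicBound d) ⟨1, fun _ h => one_le_of_isHarmonicBound h⟩

lemma one_le_gammaConst (d : ℕ) : 1 ≤ gammaConst d :=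
  one_le_of_isHarmonicBound (isHarmonicBound_gammaConst d)

/-! ### Zonal functions and their kernels -/

/-- The permutation invariant function with Fourier coefficients `c |S|`. -/
def zonal (c : ℕ → ℝ) (x : Cube n) : ℝ := ∑ S : Finset (Fin n), c S.card * character S x

/-- The polynomial representing the translate by `y` of `zonal c`. -/
def zonalPoly (c : ℕ → ℝ) (y : Cube n) : MvPolynomial (Fin n) ℝ :=
  ∑ S : Finset (Fin n), MvPolynomial.C (c S.card * character S y) *
    ∏ i ∈ S, (1 - 2 * MvPolynomial.X i)

lemma onCube_zonalPoly (c : ℕ → ℝ) (x y : Cube n) :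
    onCube (zonalPoly c y) x = zonal c (shift x y) := by
  simp only [onCube, zonalPoly, zonal, map_sum, map_mul, map_prod, map_sub, map_one, map_ofNat,
    MvPolynomial.eval_C, MvPolynomial.eval_X, character_shift]
  refine Finset.sum_congr rfl fun S _ => ?_
  rw [character, character]; ring

lemma totalDegree_zonalPoly_le {r : ℕ} {c : ℕ → ℝ} (hc : ∀ k, r < k → c k = 0) (y : Cube n) :
    (zonalPoly c y).totalDegree ≤ r := by
  refine MvPolynomial.totalDegree_finsetSum_le fun S _ => ?_
  by_cases hS : r < S.card
  · simp [hc _ hS]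
  refine (MvPolynomial.totalDegree_mul _ _).trans ?_
  rw [MvPolynomial.totalDegree_C, zero_add]
  refine (MvPolynomial.totalDegree_finsetProd _ _).trans ?_
  refine (Finset.sum_le_card_nsmul S _ 1 fun i _ => ?_).trans (by simpa using hS)
  refine (MvPolynomial.totalDegree_sub _ _).trans (max_le (by simp) ?_)
  have : (2 : MvPolynomial (Fin n) ℝ) = MvPolynomial.C 2 := (map_ofNat _ 2).symm
  rw [this]
  refine (MvPolynomial.totalDegree_mul _ _).trans ?_
  rw [MvPolynomial.totalDegree_C, MvPolynomial.totalDegree_X]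

/-- The eigenvalue of the kernel `zonal c (x + y) ^ 2` on the character `S`. -/
def eigenvalue (c : ℕ → ℝ) (S : Finset (Fin n)) : ℝ :=
  integral fun x => zonal c x ^ 2 * character S x

lemma character_comp_perm (σ : Equiv.Perm (Fin n)) (S : Finset (Fin n)) (x : Cube n) :
    character S (x ∘ σ) = character (S.map σ.toEmbedding) x := by
  simp [character, toReal]

lemma zonal_comp_perm (σ : Equiv.Perm (Fin n)) (c : ℕ → ℝ) (x : Cube n) :
    zonal c (x ∘ σ) = zonal c x := by
  simp only [zonal, character_comp_perm]
  have := Equiv.sum_comp (Equiv.finsetCongr σ) (fun S => c S.card * character S x)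
  simpa using this

lemma exists_perm_map_eq {S T : Finset (Fin n)} (h : S.card = T.card) :
    ∃ σ : Equiv.Perm (Fin n), S.map σ.toEmbedding = T := by
  let e : {x // x ∈ S} ≃ {x // x ∈ T} := Finset.equivOfCardEq h
  refine ⟨e.extendSubtype, Finset.eq_of_subset_of_card_le (fun y hy => ?_) (by simp [h])⟩
  obtain ⟨x, hx, rfl⟩ := Finset.mem_map.1 hy
  exact e.extendSubtype_mem x hx

/-- A permutation of coordinates preserves `zonal c` and the measure, and permutations act
transitively on sets of a given size. -/
lemma eigenvalue_eq_of_card_eq (c : ℕ → ℝ) {S T : Finset (Fin n)} (h : S.card = T.card) :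
    eigenvalue c S = eigenvalue c T := by
  obtain ⟨σ, rfl⟩ := exists_perm_map_eq h
  have := Equiv.sum_comp (Equiv.arrowCongr σ.symm (Equiv.refl Bool))
    (fun x : Cube n => zonal c x ^ 2 * character S x)
  simp only [eigenvalue, integral]
  rw [← this]
  congr 1
  refine Finset.sum_congr rfl fun x _ => ?_
  have hx : (Equiv.arrowCongr σ.symm (Equiv.refl Bool)) x = x ∘ σ := by
    funext i; simp [Equiv.arrowCongr]
  rw [hx, zonal_comp_perm, character_comp_perm]

lemma exists_eigenvalue_eq (c : ℕ → ℝ) (n : ℕ) :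
    ∃ l : ℕ → ℝ, ∀ S : Finset (Fin n), eigenvalue c S = l S.card := by
  classical
  refine ⟨fun k => if h : ∃ S : Finset (Fin n), S.card = k then eigenvalue c h.choose else 0,
    fun S => ?_⟩
  have h : ∃ T : Finset (Fin n), T.card = S.card := ⟨S, rfl⟩
  simp only [dif_pos h]
  exact eigenvalue_eq_of_card_eq c h.choose_spec.symm

/-- For `u, v ∈ {1, -1}`, `(1 - u) + (1 - v) - (1 - u v) = (1 - u) (1 - v) ≥ 0`; then induct on `S`.
-/
lemma one_sub_character_le (S : Finset (Fin n)) (x : Cube n) :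
    1 - character S x ≤ ∑ i ∈ S, (1 - character {i} x) := by
  classical
  induction S using Finset.induction_on with
  | empty => simp [character]
  | insert i S hi ih =>
    rw [Finset.sum_insert hi]
    have h : character (insert i S) x = character {i} x * character S x := by
      simp [character, hi]
    rw [h]
    rcases character_eq_one_or S x with h1 | h1 <;>
      rcases character_eq_one_or {i} x with h2 | h2 <;> rw [h1] at ih ⊢ <;> rw [h2] <;> linarith

/-- The first eigenvalue controls all others. -/
lemma one_sub_eigenvalue_le {c : ℕ → ℝ} {a : ℝ}
    (h1 : integral (fun x : Cube n => zonal c x ^ 2) = 1)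
    (ha : (n : ℝ) * (1 - 2 * a) ≤ ∑ i : Fin n, eigenvalue c {i}) (S : Finset (Fin n)) :
    1 - eigenvalue c S ≤ 2 * S.card * a := by
  have hsub : ∀ T : Finset (Fin n),
      1 - eigenvalue c T = integral fun x => zonal c x ^ 2 * (1 - character T x) := fun T => by
    simp only [mul_sub, mul_one]
    rw [integral_sub, h1, eigenvalue]
  have hle : 1 - eigenvalue c S ≤ ∑ i ∈ S, (1 - eigenvalue c {i}) := by
    rw [hsub]
    simp only [hsub]
    rw [← integral_sum]
    refine integral_mono fun x => ?_
    rw [← Finset.mul_sum]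
    exact mul_le_mul_of_nonneg_left (one_sub_character_le S x) (sq_nonneg _)
  have hi : ∀ i : Fin n, 1 - eigenvalue c {i} ≤ 2 * a := fun i => by
    have hn : (0 : ℝ) < n := by exact_mod_cast i.pos
    have : ∑ j : Fin n, eigenvalue c {j} = n * eigenvalue c {i} := by
      rw [Finset.sum_congr rfl fun j _ =>
        eigenvalue_eq_of_card_eq c (S := {j}) (T := {i}) (by simp)]
      simp
    rw [this] at ha
    have := le_of_mul_le_mul_left ha hn
    linarith
  calc 1 - eigenvalue c S ≤ ∑ i ∈ S, (1 - eigenvalue c {i}) := hle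
    _ ≤ ∑ i ∈ S, 2 * a := Finset.sum_le_sum fun i _ => hi i
    _ = 2 * S.card * a := by rw [Finset.sum_const, nsmul_eq_mul]; ring

/-- Characters are multiplicative for `shift`, hence eigenvectors of every convolution. -/
lemma integral_character_mul_kernel (c : ℕ → ℝ) (S : Finset (Fin n)) (x : Cube n) :
    integral (fun y => character S y * zonal c (shift x y) ^ 2) =
      eigenvalue c S * character S x := by
  rw [← integral_shift x, mul_comm, eigenvalue, ← integral_const_mul]
  simp only [shift_shift, character_shift]
  congr 1; funext y; ring

lemma integral_harmonicComponent_mul_kernel {c : ℕ → ℝ} {l : ℕ → ℝ}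
    (hl : ∀ S : Finset (Fin n), eigenvalue c S = l S.card) (k : ℕ) (g : Cube n → ℝ) (x : Cube n) :
    integral (fun y => harmonicComponent k g y * zonal c (shift x y) ^ 2) =
      l k * harmonicComponent k g x := by
  simp only [harmonicComponent, Finset.sum_mul, Finset.mul_sum]
  rw [integral_sum]
  refine Finset.sum_congr rfl fun S hS => ?_
  simp only [mul_assoc]
  rw [integral_const_mul, integral_character_mul_kernel, hl, (Finset.mem_powersetCard.1 hS).2]
  ring

lemma integral_zonal_sq_shift (c : ℕ → ℝ) (x : Cube n) :
    integral (fun y => zonal c (shift x y) ^ 2) = integral (fun y : Cube n => zonal c y ^ 2) :=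
  integral_shift x fun y => zonal c y ^ 2

lemma eigenvalue_empty (c : ℕ → ℝ) :
    eigenvalue c (∅ : Finset (Fin n)) = integral fun x : Cube n => zonal c x ^ 2 := by
  simp [eigenvalue, character_empty]

lemma sum_range_mul_two (d : ℕ) (a : ℝ) :
    ∑ k ∈ Finset.range d, 2 * ((k + 1 : ℕ) : ℝ) * a = d * (d + 1) * a := by
  induction d with
  | zero => simp
  | succ d ih => rw [Finset.sum_range_succ, ih]; push_cast; ring

/-! ### Error bounds from a zonal function -/

lemma exists_eigenvalue_bounds {c : ℕ → ℝ} {a : ℝ}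
    (h1 : integral (fun x : Cube n => zonal c x ^ 2) = 1)
    (ha : (n : ℝ) * (1 - 2 * a) ≤ ∑ i : Fin n, eigenvalue c {i}) :
    ∃ l : ℕ → ℝ, (∀ S : Finset (Fin n), eigenvalue c S = l S.card) ∧ l 0 = 1 ∧
      ∀ k ≤ n, l k ≤ 1 ∧ 1 - l k ≤ 2 * (k : ℝ) * a := by
  obtain ⟨l, hl⟩ := exists_eigenvalue_eq c n
  refine ⟨l, hl, by rw [← h1, ← eigenvalue_empty, hl]; simp, fun k hk => ?_⟩
  -- The restriction `k ≤ n` provides a set of size `k` on which `l k` is an actual eigenvalue.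
  obtain ⟨S, -, hS⟩ := Finset.exists_subset_card_eq
    (show k ≤ (Finset.univ : Finset (Fin n)).card by simpa using hk)
  constructor
  · rw [← hS, ← hl, ← h1, eigenvalue]
    refine integral_mono fun y => ?_
    rcases character_eq_one_or S y with h | h <;> rw [h] <;> nlinarith [sq_nonneg (zonal c y)]
  · have := one_sub_eigenvalue_le h1 ha S
    rwa [hl, hS] at this

lemma integral_sum_harmonicComponent_mul_kernel {c : ℕ → ℝ} {l : ℕ → ℝ}
    (hl : ∀ S : Finset (Fin n), eigenvalue c S = l S.card) (s : Finset ℕ) (b : ℕ → ℝ)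
    (g : Cube n → ℝ) (x : Cube n) :
    integral (fun y => (∑ k ∈ s, b k * harmonicComponent k g y) * zonal c (shift x y) ^ 2) =
      ∑ k ∈ s, b k * (l k * harmonicComponent k g x) := by
  simp only [Finset.sum_mul, mul_assoc]
  rw [integral_sum]
  refine Finset.sum_congr rfl fun k _ => ?_
  rw [integral_const_mul, integral_harmonicComponent_mul_kernel hl]

lemma onCube_zonalPoly_sq (c : ℕ → ℝ) (x y : Cube n) :
    onCube (zonalPoly c y ^ 2) x = zonal c (shift x y) ^ 2 := by
  rw [← onCube_zonalPoly, onCube, onCube, map_pow]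

/-- The test density is the squared kernel centred at a minimiser. The degree zero term cancels
because `l 0 = 1`. -/
lemma innerBound_sub_fMin_le {d r : ℕ} {c : ℕ → ℝ} {a : ℝ} (hc : ∀ k, r < k → c k = 0)
    (hd : d ≤ n) (h1 : integral (fun x : Cube n => zonal c x ^ 2) = 1)
    (ha : (n : ℝ) * (1 - 2 * a) ≤ ∑ i : Fin n, eigenvalue c {i})
    {p : MvPolynomial (Fin n) ℝ} (hp : p.totalDegree ≤ d) (hp1 : supNorm p = 1) :
    innerBound r p - (fMin p : EReal) ≤ ((errorConst d * a : ℝ) : EReal) := by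
  obtain ⟨l, hl, hl0, hlk⟩ := exists_eigenvalue_bounds h1 ha
  obtain ⟨x, hx⟩ := exists_onCube_eq_fMin p
  have hint : integral (fun y => onCube p y * zonal c (shift x y) ^ 2) =
      ∑ k ∈ Finset.range (d + 1), l k * harmonicComponent k (onCube p) x := by
    have := integral_sum_harmonicComponent_mul_kernel hl (Finset.range (d + 1)) (fun _ => 1)
      (onCube p) x
    simp only [one_mul, ← onCube_eq_sum_harmonicComponent hp] at this
    exact this
  have hreal : integral (fun y => onCube p y * zonal c (shift x y) ^ 2) - fMin p ≤
      errorConst d * a := by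
    rw [hint, ← hx, onCube_eq_sum_harmonicComponent hp x, ← Finset.sum_sub_distrib,
      Finset.sum_range_succ', hl0]
    have : ∑ k ∈ Finset.range d, (l (k + 1) * harmonicComponent (k + 1) (onCube p) x -
        harmonicComponent (k + 1) (onCube p) x) ≤
        ∑ k ∈ Finset.range d, gammaConst d * (2 * ((k + 1 : ℕ) : ℝ) * a) := by
      refine Finset.sum_le_sum fun k hk => ?_
      have hkd : k + 1 ≤ d := by simpa using hk
      have hh := isHarmonicBound_gammaConst d n p hp (k + 1) hkd x
      rw [hp1, mul_one] at hh
      obtain ⟨hle, hge⟩ := hlk (k + 1) (hkd.trans hd)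
      have e1 := mul_le_mul_of_nonneg_left (abs_le.1 hh).1 (sub_nonneg.2 hle)
      have e2 := mul_le_mul_of_nonneg_left hge (zero_le_one.trans (one_le_gammaConst d))
      linarith
    rw [← Finset.mul_sum, sum_range_mul_two] at this
    rw [errorConst]
    linarith
  have hsq : onCube (zonalPoly c x ^ 2) = fun y => zonal c (shift x y) ^ 2 := by
    funext y
    rw [onCube_zonalPoly_sq, shift_comm]
  have hin : innerBound r p ≤
      ((integral (fun y => onCube p y * zonal c (shift x y) ^ 2) : ℝ) : EReal) := by
    refine sInf_le ⟨zonalPoly c x ^ 2, ⟨1, fun _ => zonalPoly c x,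
      fun _ => totalDegree_zonalPoly_le hc x, by simp⟩, ?_, ?_⟩
    · rw [hsq, integral_zonal_sq_shift, h1]
    · rw [hsq]
  refine (EReal.sub_le_sub hin le_rfl).trans ?_
  rw [← EReal.coe_sub]
  exact_mod_cast hreal

/-- Integrating squares against a nonnegative weight gives a sum of squares. -/
lemma exists_isSOS_integral_kernel {r : ℕ} {c : ℕ → ℝ} (hc : ∀ k, r < k → c k = 0)
    {g : Cube n → ℝ} (hg : ∀ y, 0 ≤ g y) :
    ∃ s : MvPolynomial (Fin n) ℝ, IsSOS r s ∧
      ∀ x, onCube s x = integral fun y => g y * zonal c (shift x y) ^ 2 := by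
  let q : Cube n → MvPolynomial (Fin n) ℝ := fun y =>
    MvPolynomial.C (Real.sqrt (g y / 2 ^ n)) * zonalPoly c y
  refine ⟨∑ y, q y ^ 2, ⟨Fintype.card (Cube n), fun i => q ((Fintype.equivFin _).symm i),
    fun i => ?_, ?_⟩, fun x => ?_⟩
  · refine (MvPolynomial.totalDegree_mul _ _).trans ?_
    rw [MvPolynomial.totalDegree_C, zero_add]
    exact totalDegree_zonalPoly_le hc _
  · exact (Equiv.sum_comp (Fintype.equivFin (Cube n)).symm fun y => q y ^ 2).symm
  · rw [integral, Finset.sum_div, onCube, map_sum]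
    refine Finset.sum_congr rfl fun y _ => ?_
    have h := onCube_zonalPoly_sq c x y
    rw [onCube, map_pow] at h
    rw [map_pow, map_mul, mul_pow, h, MvPolynomial.eval_C,
      Real.sq_sqrt (div_nonneg (hg y) (by positivity))]
    ring

/-- The condition `2 * d * a < 1` keeps `l k` positive for `k ≤ d`, so the kernel operator is
invertible on degree at most `d`. -/
lemma fMin_sub_outerBound_le {d r : ℕ} {c : ℕ → ℝ} {a : ℝ} (hc : ∀ k, r < k → c k = 0)
    (hd : d ≤ n) (h1 : integral (fun x : Cube n => zonal c x ^ 2) = 1)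
    (ha : (n : ℝ) * (1 - 2 * a) ≤ ∑ i : Fin n, eigenvalue c {i}) (ha0 : 0 ≤ a)
    (had : 2 * d * a < 1)
    {p : MvPolynomial (Fin n) ℝ} (hp : p.totalDegree ≤ d) (hp1 : supNorm p = 1) :
    (fMin p : EReal) - outerBound r p ≤ ((errorConst d * (a / (1 - 2 * d * a)) : ℝ) : EReal) := by
  obtain ⟨l, hl, hl0, hlk⟩ := exists_eigenvalue_bounds h1 ha
  set ε := errorConst d * (a / (1 - 2 * d * a)) with hε
  have hpos : ∀ k ≤ d, 1 - 2 * d * a ≤ l k := fun k hk => by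
    have h := (hlk k (hk.trans hd)).2
    have : (k : ℝ) * a ≤ d * a := mul_le_mul_of_nonneg_right (by exact_mod_cast hk) ha0
    linarith
  -- The preimage of `p - fMin p + ε` under the kernel operator, which fixes constants.
  let g : Cube n → ℝ := fun y =>
    (ε - fMin p) + ∑ k ∈ Finset.range (d + 1), (l k)⁻¹ * harmonicComponent k (onCube p) y
  have hg : ∀ y, 0 ≤ g y := fun y => by
    have hsum : ∑ k ∈ Finset.range d, gammaConst d * (2 * ((k + 1 : ℕ) : ℝ) * (a / (1 - 2 * d * a)))
        = ε := by
      rw [← Finset.mul_sum, sum_range_mul_two, hε, errorConst]; ring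
    have hterm : ∑ k ∈ Finset.range d, (harmonicComponent (k + 1) (onCube p) y -
        (l (k + 1))⁻¹ * harmonicComponent (k + 1) (onCube p) y) ≤ ε := by
      rw [← hsum]
      refine Finset.sum_le_sum fun k hk => ?_
      have hkd : k + 1 ≤ d := by simpa using hk
      have hh := isHarmonicBound_gammaConst d n p hp (k + 1) hkd y
      rw [hp1, mul_one] at hh
      obtain ⟨hle, hge⟩ := hlk (k + 1) (hkd.trans hd)
      have hlpos : 0 < l (k + 1) := by linarith [hpos _ hkd]
      have hinv : 0 ≤ (l (k + 1))⁻¹ - 1 := sub_nonneg.2 ((one_le_inv₀ hlpos).2 hle)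
      have hinv' : (l (k + 1))⁻¹ - 1 ≤ 2 * ((k + 1 : ℕ) : ℝ) * (a / (1 - 2 * d * a)) := by
        have : (l (k + 1))⁻¹ - 1 = (1 - l (k + 1)) / l (k + 1) := by field_simp
        rw [this, ← mul_div_assoc]
        exact div_le_div₀ (by positivity) hge (by linarith) (hpos _ hkd)
      have e1 := mul_le_mul_of_nonneg_left (abs_le.1 hh).1 hinv
      have e2 := mul_le_mul_of_nonneg_left hinv' (zero_le_one.trans (one_le_gammaConst d))
      linarith
    have hf := fMin_le p y
    rw [onCube_eq_sum_harmonicComponent hp y, Finset.sum_range_succ'] at hf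
    simp only [g]
    rw [Finset.sum_range_succ', hl0]
    rw [Finset.sum_sub_distrib] at hterm
    simp only [inv_one, one_mul]
    linarith
  obtain ⟨s, hs, hsx⟩ := exists_isSOS_integral_kernel hc hg
  have hrep : ∀ x, onCube p x - (fMin p - ε) = onCube s x := fun x => by
    rw [hsx]
    simp only [g, add_mul]
    rw [integral_add, integral_const_mul, integral_zonal_sq_shift, h1,
      integral_sum_harmonicComponent_mul_kernel hl, onCube_eq_sum_harmonicComponent hp x]
    have : ∑ k ∈ Finset.range (d + 1), (l k)⁻¹ * (l k * harmonicComponent k (onCube p) x) =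
        ∑ k ∈ Finset.range (d + 1), harmonicComponent k (onCube p) x :=
      Finset.sum_congr rfl fun k hk => by
        have hlpos : 0 < l k := by
          linarith [hpos k (by simpa [Nat.lt_succ_iff] using hk)]
        rw [inv_mul_cancel_left₀ hlpos.ne']
    rw [this]; ring
  have hout : ((fMin p - ε : ℝ) : EReal) ≤ outerBound r p := le_sSup ⟨_, rfl, s, hs, hrep⟩
  refine (EReal.sub_le_sub le_rfl hout).trans ?_
  rw [← EReal.coe_sub]
  simp

/-! ### A zonal function with large first eigenvalue -/

/-- In the expanded square, `χ_S χ_T χ_U` has nonzero integral only for `T = symmDiff S U`. -/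
lemma eigenvalue_eq_sum (c : ℕ → ℝ) (U : Finset (Fin n)) :
    eigenvalue c U = ∑ S : Finset (Fin n), c S.card * c (symmDiff S U).card := by
  have h : ∀ x : Cube n, zonal c x ^ 2 * character U x = ∑ S : Finset (Fin n),
      ∑ T : Finset (Fin n), (c S.card * c T.card) *
        (character (symmDiff S U) x * character T x) := fun x => by
    rw [sq, zonal, Finset.sum_mul_sum, Finset.sum_mul]
    refine Finset.sum_congr rfl fun S _ => ?_
    rw [Finset.sum_mul]
    refine Finset.sum_congr rfl fun T _ => ?_
    rw [← character_mul]; ring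
  simp only [eigenvalue, h]
  rw [integral_sum]
  refine Finset.sum_congr rfl fun S _ => ?_
  rw [integral_sum]
  simp only [integral_const_mul, integral_character_mul]
  simp

lemma sum_finset_apply_card (F : ℕ → ℝ) :
    ∑ S : Finset (Fin n), F S.card = ∑ k ∈ Finset.range (n + 1), (n.choose k : ℝ) * F k := by
  rw [← Finset.powerset_univ, Finset.sum_powerset_apply_card]
  simp

lemma integral_zonal_sq (c : ℕ → ℝ) :
    integral (fun x : Cube n => zonal c x ^ 2) =
      ∑ k ∈ Finset.range (n + 1), (n.choose k : ℝ) * c k ^ 2 := by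
  rw [← eigenvalue_empty, eigenvalue_eq_sum, ← sum_finset_apply_card]
  refine Finset.sum_congr rfl fun S _ => ?_
  rw [← Finset.bot_eq_empty, symmDiff_bot, sq]

/-- Toggling `i` lowers the size when `i ∈ S` and raises it otherwise. For empty `S` the truncated
`S.card - 1` is multiplied by zero. -/
lemma sum_card_symmDiff_singleton (c : ℕ → ℝ) (S : Finset (Fin n)) :
    ∑ i : Fin n, c (symmDiff S {i}).card =
      S.card * c (S.card - 1) + (n - S.card : ℝ) * c (S.card + 1) := by
  classical
  rw [← Finset.sum_add_sum_compl S]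
  have h1 : ∑ i ∈ S, c (symmDiff S {i}).card = ∑ i ∈ S, c (S.card - 1) :=
    Finset.sum_congr rfl fun i hi => by
      have : symmDiff S {i} = S.erase i := by
        ext j; by_cases hj : j = i <;> simp [Finset.mem_symmDiff, hj, hi]
      rw [this, Finset.card_erase_of_mem hi]
  have h2 : ∑ i ∈ Sᶜ, c (symmDiff S {i}).card = ∑ i ∈ Sᶜ, c (S.card + 1) :=
    Finset.sum_congr rfl fun i hi => by
      have hi' : i ∉ S := by simpa using hi
      have : symmDiff S {i} = insert i S := by
        ext j; by_cases hj : j = i <;> simp [Finset.mem_symmDiff, hj, hi']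
      rw [this, Finset.card_insert_of_notMem hi']
  rw [h1, h2, Finset.sum_const, Finset.sum_const, Finset.card_compl, nsmul_eq_mul, nsmul_eq_mul,
    Fintype.card_fin, Nat.cast_sub (by simpa using Finset.card_le_univ S)]

/-- Each pair of adjacent degrees is counted from below and from above; the counts agree because `(k
+ 1) * choose n (k + 1) = (n - k) * choose n k`, whence the factor two. -/
lemma sum_eigenvalue_singleton (c : ℕ → ℝ) :
    ∑ i : Fin n, eigenvalue c {i} =
      2 * ∑ k ∈ Finset.range n, (n.choose k : ℝ) * (n - k) * (c k * c (k + 1)) := by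
  simp only [eigenvalue_eq_sum]
  rw [Finset.sum_comm]
  simp only [← Finset.mul_sum, sum_card_symmDiff_singleton]
  rw [sum_finset_apply_card fun k => c k * (k * c (k - 1) + (n - k : ℝ) * c (k + 1))]
  simp only [mul_add]
  rw [Finset.sum_add_distrib, Finset.sum_range_succ', Finset.sum_range_succ _ n, two_mul]
  simp only [Nat.cast_zero, zero_mul, mul_zero, add_zero, sub_self, Nat.add_sub_cancel]
  congr 1
  · refine Finset.sum_congr rfl fun k hk => ?_
    have h := Nat.choose_succ_right_eq n k
    have hR : (n.choose (k + 1) : ℝ) * (k + 1) = n.choose k * (n - k) := by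
      rw [← Nat.cast_sub (Finset.mem_range.1 hk).le]; exact_mod_cast h
    rw [← hR]; push_cast; ring
  · exact Finset.sum_congr rfl fun k _ => by ring

/-- Equidistributing mass over the degrees in `(r - m - 1, r]` makes the first eigenvalue large. -/
lemma exists_zonal_of_window {r m : ℕ} (hm : m + 1 ≤ r) (hr : r ≤ n) :
    ∃ c : ℕ → ℝ, (∀ k, r < k → c k = 0) ∧ integral (fun x : Cube n => zonal c x ^ 2) = 1 ∧
      2 * (m / (m + 1)) * Real.sqrt ((r - (m + 1)) * (n - r)) ≤
        ∑ i : Fin n, eigenvalue c {i} := by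
  classical
  -- Chosen so that each of the `m + 1` degrees in the window carries mass `choose n k * c k ^ 2 = 1
  -- / (m + 1)`.
  let c : ℕ → ℝ := fun k =>
    if k ∈ Finset.Ioc (r - (m + 1)) r then (Real.sqrt ((m + 1) * n.choose k))⁻¹ else 0
  have hc0 : ∀ k, 0 ≤ c k := fun k => by simp only [c]; split_ifs <;> positivity
  refine ⟨c, fun k hk => ?_, ?_, ?_⟩
  · simp only [c]; rw [if_neg]; simp; omega
  · rw [integral_zonal_sq]
    have h : ∀ k ∈ Finset.range (n + 1), (n.choose k : ℝ) * c k ^ 2 =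
        if k ∈ Finset.Ioc (r - (m + 1)) r then ((m : ℝ) + 1)⁻¹ else 0 := fun k hk => by
      have hpos : (0 : ℝ) < n.choose k := by
        exact_mod_cast Nat.choose_pos (by simpa [Nat.lt_succ_iff] using hk)
      simp only [c]
      split_ifs
      · rw [inv_pow, Real.sq_sqrt (by positivity)]; field_simp
      · simp
    rw [Finset.sum_congr rfl h, Finset.sum_ite_mem, Finset.inter_eq_right.2 fun k hk => by
      simp at hk ⊢; omega]
    rw [Finset.sum_const, Nat.card_Ioc, Nat.sub_sub_self hm, nsmul_eq_mul]
    push_cast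
    field_simp
  · rw [sum_eigenvalue_singleton, mul_assoc]
    refine mul_le_mul_of_nonneg_left ?_ (by norm_num)
    have hsub : Finset.Ioo (r - (m + 1)) r ⊆ Finset.range n := fun k hk => by
      simp at hk ⊢; omega
    refine le_trans ?_ (Finset.sum_le_sum_of_subset_of_nonneg hsub fun k hk _ => ?_)
    -- Each of the `m` adjacent pairs in the window contributes exactly `√((k + 1) (n - k)) / (m +
    -- 1)`, bounded below using the ends of the window.
    · have hterm : ∀ k ∈ Finset.Ioo (r - (m + 1)) r,
          Real.sqrt ((r - (m + 1)) * (n - r)) / (m + 1) ≤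
            (n.choose k : ℝ) * (n - k) * (c k * c (k + 1)) := fun k hk => by
        obtain ⟨hk1, hk2⟩ := Finset.mem_Ioo.1 hk
        have hu : (0 : ℝ) < n.choose k := by exact_mod_cast Nat.choose_pos (by omega)
        have hv : (0 : ℝ) < n.choose (k + 1) := by exact_mod_cast Nat.choose_pos (by omega)
        have hck : c k = (Real.sqrt ((m + 1) * n.choose k))⁻¹ := if_pos (by simp; omega)
        have hck' : c (k + 1) = (Real.sqrt ((m + 1) * n.choose (k + 1)))⁻¹ :=
          if_pos (by simp; omega)
        have hR : (n.choose (k + 1) : ℝ) * (k + 1) = n.choose k * (n - k) := by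
          rw [← Nat.cast_sub (by omega : k ≤ n)]; exact_mod_cast Nat.choose_succ_right_eq n k
        have hkn : (0 : ℝ) < n - k := by
          rw [sub_pos]; exact_mod_cast (by omega : k < n)
        have hrk : (r : ℝ) - (m + 1) ≤ k + 1 := by
          have : r ≤ k + 1 + (m + 1) := by omega
          have : (r : ℝ) ≤ k + 1 + (m + 1) := by exact_mod_cast this
          linarith
        have hnr : (n : ℝ) - r ≤ n - k := by
          have : (k : ℝ) ≤ r := by exact_mod_cast hk2.le
          linarith
        have hrm : (0 : ℝ) ≤ r - (m + 1) := by
          rw [sub_nonneg]; exact_mod_cast hm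
        have hnr0 : (0 : ℝ) ≤ n - r := by rw [sub_nonneg]; exact_mod_cast hr
        rw [hck, hck', ← mul_inv, ← Real.sqrt_mul (by positivity), ← div_eq_mul_inv]
        generalize (n.choose k : ℝ) = u at *
        generalize (n.choose (k + 1) : ℝ) = v at *
        have hsq : Real.sqrt ((m + 1) * u * ((m + 1) * v)) = (m + 1) * Real.sqrt (u * v) := by
          rw [show ((m : ℝ) + 1) * u * ((m + 1) * v) = (m + 1) ^ 2 * (u * v) by ring,
            Real.sqrt_mul (by positivity), Real.sqrt_sq (by positivity)]
        rw [hsq, div_le_div_iff₀ (by positivity) (by positivity)]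
        have hkey : Real.sqrt ((r - (m + 1)) * (n - r)) * Real.sqrt (u * v) ≤ u * (n - k) := by
          rw [← Real.sqrt_mul (by positivity)]
          refine Real.sqrt_le_iff.2 ⟨by positivity, ?_⟩
          calc ((r : ℝ) - (m + 1)) * (n - r) * (u * v) ≤ (k + 1) * (n - k) * (u * v) := by
                gcongr
            _ = u * (n - k) * (v * (k + 1)) := by ring
            _ = (u * (n - k)) ^ 2 := by rw [hR]; ring
        calc Real.sqrt ((r - (m + 1)) * (n - r)) * ((m + 1) * Real.sqrt (u * v))
            = (Real.sqrt ((r - (m + 1)) * (n - r)) * Real.sqrt (u * v)) * (m + 1) := by ring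
          _ ≤ _ := mul_le_mul_of_nonneg_right hkey (by positivity)
      refine le_trans (le_of_eq ?_) (Finset.card_nsmul_le_sum _ _ _ hterm)
      have hcard : (Finset.Ioo (r - (m + 1)) r).card = m := by
        rw [Nat.card_Ioo]; omega
      rw [hcard, nsmul_eq_mul]
      ring
    · have hkn : (0 : ℝ) ≤ n - k := by
        rw [sub_nonneg]; exact_mod_cast (Finset.mem_range.1 hk).le
      exact mul_nonneg (mul_nonneg (Nat.cast_nonneg _) hkn) (mul_nonneg (hc0 _) (hc0 _))

/-! ### Asymptotics as `r / n → t` -/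

lemma phi_nonneg {t : ℝ} : 0 ≤ phi t := by
  rw [phi, sub_nonneg]
  refine Real.sqrt_le_iff.2 ⟨by norm_num, ?_⟩
  nlinarith [sq_nonneg (t - 1 / 2)]

/-- Asymptotically, zonal functions of degree `r` with `r / n → t` reach `phi t`. -/
lemma eventually_exists_zonal {t : ℝ} (ht : t ∈ Set.Icc (0 : ℝ) (1 / 2)) {n r : ℕ → ℕ}
    (hn : Tendsto n atTop atTop)
    (hr : Tendsto (fun j => (r j : ℝ) / (n j : ℝ)) atTop (𝓝 t)) {a : ℝ} (ha : phi t < a) :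
    ∀ᶠ j in atTop, ∃ c : ℕ → ℝ, (∀ k, r j < k → c k = 0) ∧
      integral (fun x : Cube (n j) => zonal c x ^ 2) = 1 ∧
      (n j : ℝ) * (1 - 2 * a) ≤ ∑ i : Fin (n j), eigenvalue c {i} := by
  have hnR : Tendsto (fun j => (n j : ℝ)) atTop atTop := tendsto_natCast_atTop_atTop.comp hn
  rcases ht.1.eq_or_lt with rfl | ht0
  -- At `t = 0` the degree may be too small for a window, but `a > φ(0) = 1/2` makes the required
  -- bound negative or zero, so the constant function one suffices.
  · refine Eventually.of_forall fun j => ⟨fun k => if k = 0 then 1 else 0, fun k hk => ?_, ?_, ?_⟩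
    · exact if_neg (by omega)
    · rw [integral_zonal_sq, Finset.sum_range_succ']
      simp
    · rw [sum_eigenvalue_singleton]
      simp only [Nat.succ_ne_zero, if_false, mul_zero, Finset.sum_const_zero]
      refine mul_nonpos_of_nonneg_of_nonpos (Nat.cast_nonneg _) ?_
      simp [phi] at ha
      linarith
  · have hsqrt : 1 - 2 * a < 2 * 1 * Real.sqrt (t * (1 - t)) := by
      rw [phi] at ha; linarith
    have hlim : Tendsto (fun m : ℕ => 2 * ((m : ℝ) / (m + 1)) * Real.sqrt (t * (1 - t))) atTop
        (𝓝 (2 * 1 * Real.sqrt (t * (1 - t)))) :=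
      ((tendsto_natCast_div_add_atTop (1 : ℝ)).const_mul 2).mul_const _
    -- The window length is fixed before `j`: the loss `m / (m + 1)` fits in the slack `a - φ(t)`,
    -- and `(m + 1) / n j` then tends to zero.
    obtain ⟨m, hm⟩ := (hlim.eventually_const_lt hsqrt).exists
    have hrR : Tendsto (fun j => (r j : ℝ)) atTop atTop := by
      refine (hr.pos_mul_atTop ht0 hnR).congr' ?_
      filter_upwards [hnR.eventually_gt_atTop 0] with j hj
      field_simp
    have hlim2 : Tendsto (fun j => 2 * ((m : ℝ) / (m + 1)) *
        Real.sqrt (((r j : ℝ) / n j - (m + 1) / n j) * (1 - (r j : ℝ) / n j))) atTop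
        (𝓝 (2 * ((m : ℝ) / (m + 1)) * Real.sqrt ((t - 0) * (1 - t)))) :=
      (((hr.sub (hnR.const_div_atTop _)).mul (tendsto_const_nhds.sub hr)).sqrt).const_mul _
    rw [sub_zero] at hlim2
    filter_upwards [hlim2.eventually_const_lt hm, hnR.eventually_gt_atTop 0,
      hrR.eventually_ge_atTop (m + 1 : ℝ),
      hr.eventually_lt_const (show t < 1 by linarith [ht.2])] with j h1 h2 h3 h4
    have hrn : r j ≤ n j := by
      rw [div_lt_one h2] at h4; exact_mod_cast h4.le
    obtain ⟨c, hc, hc1, hc2⟩ := exists_zonal_of_window (by exact_mod_cast h3) hrn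
    refine ⟨c, hc, hc1, le_trans ?_ hc2⟩
    have hs : Real.sqrt (((r j : ℝ) - (m + 1)) * (n j - r j)) =
        n j * Real.sqrt (((r j : ℝ) / n j - (m + 1) / n j) * (1 - (r j : ℝ) / n j)) := by
      have hfac : ((r j : ℝ) - (m + 1)) * (n j - r j) =
          (n j : ℝ) ^ 2 * (((r j : ℝ) / n j - (m + 1) / n j) * (1 - (r j : ℝ) / n j)) := by
        field_simp
      rw [hfac, Real.sqrt_mul (by positivity), Real.sqrt_sq h2.le]
    rw [hs]
    calc (n j : ℝ) * (1 - 2 * a) ≤ n j * _ := mul_le_mul_of_nonneg_left h1.le h2.le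
      _ = _ := by ring

lemma errorConst_nonneg (d : ℕ) : 0 ≤ errorConst d := by
  have := zero_le_one.trans (one_le_gammaConst d)
  unfold errorConst; positivity

lemma limsup_innerError_le (d : ℕ) {t : ℝ} (ht : t ∈ Set.Icc (0 : ℝ) (1 / 2)) {n r : ℕ → ℕ}
    (hn : Tendsto n atTop atTop)
    (hr : Tendsto (fun j => (r j : ℝ) / (n j : ℝ)) atTop (𝓝 t)) :
    limsup (fun j => innerError d (r j) (n j)) atTop ≤ ((errorConst d * phi t : ℝ) : EReal) := by
  refine EReal.le_of_forall_lt_iff_le.1 fun B hB => ?_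
  have hB' : errorConst d * phi t < B := by exact_mod_cast hB
  have hcont : Tendsto (fun a => errorConst d * a) (𝓝[>] phi t) (𝓝 (errorConst d * phi t)) :=
    (continuous_const.mul continuous_id).continuousAt.tendsto.mono_left nhdsWithin_le_nhds
  -- Strict room below `B` lets `a` lie slightly above `φ(t)`, as the construction requires.
  obtain ⟨a, haB, ha⟩ := ((hcont.eventually_lt_const hB').and self_mem_nhdsWithin).exists
  refine limsup_le_of_le (by isBoundedDefault) ?_
  filter_upwards [eventually_exists_zonal ht hn hr ha, hn.eventually_ge_atTop d]
    with j ⟨c, hc, h1, h2⟩ hd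
  refine sSup_le ?_
  rintro e ⟨p, hp, hp1, rfl⟩
  exact (innerBound_sub_fMin_le hc hd h1 h2 hp hp1).trans (by exact_mod_cast haB.le)

lemma limsup_outerError_le (d : ℕ) {t : ℝ} (ht : t ∈ Set.Icc (0 : ℝ) (1 / 2)) {n r : ℕ → ℕ}
    (hn : Tendsto n atTop atTop)
    (hr : Tendsto (fun j => (r j : ℝ) / (n j : ℝ)) atTop (𝓝 t))
    (hdt : (d : ℝ) * (d + 1) * phi t ≤ 1 / 2) :
    limsup (fun j => outerError d (r j) (n j)) atTop ≤
      ((2 * errorConst d * phi t : ℝ) : EReal) := by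
  have hφ : 0 ≤ phi t := phi_nonneg
  -- Since `2 d ≤ d (d + 1)` for natural `d`, the denominator `1 - 2 d φ(t)` is at least `1/2`; this
  -- is the source of the factor two.
  have hd2 : 2 * d * phi t ≤ 1 / 2 := by
    refine le_trans (mul_le_mul_of_nonneg_right ?_ hφ) hdt
    have : 2 * d ≤ d * (d + 1) := by
      rcases Nat.eq_zero_or_pos d with rfl | h
      · simp
      · nlinarith
    exact_mod_cast this
  refine EReal.le_of_forall_lt_iff_le.1 fun B hB => ?_
  have hB' : 2 * errorConst d * phi t < B := by exact_mod_cast hB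
  have hval : errorConst d * (phi t / (1 - 2 * d * phi t)) < B := by
    refine lt_of_le_of_lt ?_ hB'
    rw [mul_comm 2 (errorConst d), mul_assoc (errorConst d)]
    refine mul_le_mul_of_nonneg_left ?_ (errorConst_nonneg d)
    rw [div_le_iff₀ (by linarith)]
    nlinarith
  have hcont : ContinuousAt (fun a => errorConst d * (a / (1 - 2 * d * a))) (phi t) := by
    have : 1 - 2 * d * phi t ≠ 0 := by linarith
    exact continuousAt_const.mul (continuousAt_id.div (by fun_prop) this)
  have hcont' : ContinuousAt (fun a : ℝ => 2 * d * a) (phi t) := by fun_prop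
  have e1 : ∀ᶠ a in 𝓝[>] phi t, errorConst d * (a / (1 - 2 * d * a)) < B :=
    nhdsWithin_le_nhds (hcont.tendsto.eventually_lt_const hval)
  have e2 : ∀ᶠ a : ℝ in 𝓝[>] phi t, 2 * d * a < 1 :=
    nhdsWithin_le_nhds (hcont'.tendsto.eventually_lt_const (by linarith))
  obtain ⟨a, haB, had, ha⟩ := (e1.and (e2.and self_mem_nhdsWithin)).exists
  refine limsup_le_of_le (by isBoundedDefault) ?_
  filter_upwards [eventually_exists_zonal ht hn hr ha, hn.eventually_ge_atTop d]
    with j ⟨c, hc, h1, h2⟩ hd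
  refine sSup_le ?_
  rintro e ⟨p, hp, hp1, rfl⟩
  exact (fMin_sub_outerBound_le hc hd h1 h2 (hφ.trans (le_of_lt ha)) had hp hp1).trans
    (by exact_mod_cast haB.le)

end BoolCube

end

theorem corollary4 (d : ℕ) :
    (1 ≤ d → 0 < BoolCube.errorConst d) ∧
    BoolCube.IsHarmonicBound d (BoolCube.gammaConst d) ∧
    ∀ t ∈ Set.Icc (0 : ℝ) (1 / 2), ∀ n r : ℕ → ℕ,
      Tendsto n atTop atTop →
      Tendsto (fun j => (r j : ℝ) / (n j : ℝ)) atTop (𝓝 t) →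
      limsup (fun j => BoolCube.innerError d (r j) (n j)) atTop
          ≤ ((BoolCube.errorConst d * BoolCube.phi t : ℝ) : EReal) ∧
      ((d : ℝ) * (d + 1) * BoolCube.phi t ≤ 1 / 2 →
        limsup (fun j => BoolCube.outerError d (r j) (n j)) atTop
          ≤ ((2 * BoolCube.errorConst d * BoolCube.phi t : ℝ) : EReal)) := by
  refine ⟨fun hd => ?_, BoolCube.isHarmonicBound_gammaConst d, fun t ht n r hn hr =>
    ⟨BoolCube.limsup_innerError_le d ht hn hr, BoolCube.limsup_outerError_le d ht hn hr⟩⟩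
  have hγ : 0 < BoolCube.gammaConst d := zero_lt_one.trans_le (BoolCube.one_le_gammaConst d)
  have hd' : (0 : ℝ) < d := by exact_mod_cast hd
  unfold BoolCube.errorConst
  positivity
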